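/- Let $G$ be a finite group. A rational $G$-Mackey functor $M$ consists of $\mathbb{Q}$-modules $M(G/H)$ for all subgroups $H\leqslant G$ with linear maps $R^H_K\colon M(G/H)\to M(G/K)$ (restriction) and $I^H_K\colon M(G/K)\to M(G/H)$ (induction) for $K\leqslant H$, and $C_g\colon M(G/H)\to M(G/gHg^{-1})$ (conjugation) for $g\in G$, such that (1) $R^H_H=I^H_H=\mathrm{id}$, and $C_h=\mathrm{id}$ on $M(G/H)$ for $h\in H$; (2) $I^H_L=I^H_K I^K_L$ and $R^H_L=R^K_L R^H_K$ for $L\leqslant K\leqslant H$, and $C_{gh}=C_gC_h$ for $g,h\in G$; (3) $R^{gHg^{-1}}_{gKg^{-1}}C_g=C_gR^H_K$ and $I^{gHg^{-1}}_{gKg^{-1}}C_g=C_gI^H_K$ for $K\leqslant H$ and $g\in G$; (4) $R^H_K I^H_L=\sum_{x} I^K_{K\cap xLx^{-1}}\, C_x\, R^L_{L\cap x^{-1}Kx}$ for $K,L\leqslant H$, where $x$ runs over a set of representatives of the double cosets $K\backslash H/L$. A morphism $M\to N$ is a family of linear maps $M(G/H)\to N(G/H)$ that commutes with restriction, induction and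 conjugation. For $H\leqslant G$ the rational Burnside ring $A_{\mathbb{Q}}(H)$ has as additive basis the classes $[H/K]$ of the transitive $H$-sets, one for each $H$-conjugacy class of subgroups $K\leqslant H$. It acts on $M(G/H)$ through the linear extension of $[H/K]\mapsto I^H_K R^H_K$. Let $e_H^H\in A_{\mathbb{Q}}(H)$ be the idempotent that corresponds to the characteristic function of the class $(H)$ under the isomorphism $A_{\mathbb{Q}}(H)\cong\prod_{(L)\leqslant H}\mathbb{Q}$, $[T]\mapsto(|T^L|)_{(L)}$. The subspace $e_H^HM(G/H)\subseteq M(G/H)$ is stable under the maps $C_n$ with $n\in N_GH$, and so it is a module over $\mathbb{Q}[W_GH]$, where $W_GH=N_GH/H$. Then a rational $G$-Mackey functor is determined up to isomorphism by the $\mathbb{Q}[W_GH]$-modules $e_H^HM(G/H)$, one for each conjugacy class $(H)$ of subgroups of $G$: choose a representative $H$ of each conjugacy class. Two rational $G$-Mackey functors $M$ and $N$ are isomorphic if and only if, for each chosen $H$, the $\mathbb{Q}[W_GH]$-modules $e_H^HM(G/H)$ and $e_H^HN(G/H)$ are isomorphic. -/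

import Mathlib

open scoped Pointwise
open CategoryTheory

universe u v

noncomputable section

/-! ### Conjugacy classes of subgroups -/

/-- Two subgroups `K`, `L` of `G` are conjugate if `g K g⁻¹ = L` for some `g : G`. -/
def subgroupConjSetoid (G : Type u) [Group G] : Setoid (Subgroup G) where
  r K L := ∃ g : G, MulAut.conj g • K = L
  iseqv :=
    { refl := fun K => ⟨1, by simp⟩
      symm := by
        rintro K L ⟨g, rfl⟩
        exact ⟨g⁻¹, by rw [map_inv, inv_smul_smul]⟩
      trans := by
        rintro K L P ⟨g, rfl⟩ ⟨h, rfl⟩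
        exact ⟨h * g, by rw [map_mul, mul_smul]⟩ }

/-- The set of conjugacy classes `(K)` of subgroups of `G`. -/
abbrev SubgroupConjClass (G : Type u) [Group G] : Type u := Quotient (subgroupConjSetoid G)

/-- The conjugacy class `(K)` of a subgroup `K`. -/
abbrev SubgroupConjClass.mk {G : Type u} [Group G] (K : Subgroup G) : SubgroupConjClass G :=
  Quotient.mk (subgroupConjSetoid G) K

/-- The Weyl group `W_G H = N_G H / H`. -/
abbrev WeylGroup {G : Type u} [Group G] (H : Subgroup G) : Type u :=
  Subgroup.normalizer (H : Set G) ⧸ H.subgroupOf (Subgroup.normalizer (H : Set G))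

/-! ### The rational Burnside ring and its idempotents -/

/-- The number `|(G/K)^L|` of `L`-fixed points of the `G`-set `G/K`. -/
def orbitMark {G : Type u} [Group G] (L K : Subgroup G) : ℚ :=
  (Nat.card (MulAction.fixedPoints L (G ⧸ K)) : ℚ)

theorem smul_conj_aut {G : Type u} [Group G] (φ : MulAut G) (g : G) (K : Subgroup G) :
    φ • (MulAut.conj g • K) = MulAut.conj (φ g) • (φ • K) := by
  rw [← mul_smul, ← mul_smul]
  congr 1
  ext x
  simp

/-- `|{x ∈ G : L ≤ x K x⁻¹}| = |(G/K)^L| * |K|`. -/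
theorem card_conj_le {G : Type u} [Group G] [Finite G] (L K : Subgroup G) :
    (Nat.card {x : G // L ≤ MulAut.conj x • K} : ℚ) = orbitMark L K * Nat.card K := by
  unfold orbitMark
  rw [mul_comm, ← Nat.cast_mul, ← Nat.card_prod,
    ← Nat.card_congr (QuotientGroup.preimageMkEquivSubgroupProdSet K
      (MulAction.fixedPoints L (G ⧸ K)))]
  congr 1
  apply Nat.card_congr
  apply Equiv.subtypeEquivRight
  intro x
  simp only [Set.mem_preimage, MulAction.mem_fixedPoints]
  constructor
  · rintro h ⟨l, hl⟩
    have h1 := h hl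
    rw [Subgroup.mem_pointwise_smul_iff_inv_smul_mem, ← map_inv] at h1
    change ((l * x : G) : G ⧸ K) = (x : G ⧸ K)
    refine Eq.symm (QuotientGroup.eq.2 ?_)
    simpa [mul_assoc] using h1
  · intro h l hl
    have h1 : ((l * x : G) : G ⧸ K) = (x : G ⧸ K) := h ⟨l, hl⟩
    have h2 := QuotientGroup.eq.1 h1.symm
    rw [Subgroup.mem_pointwise_smul_iff_inv_smul_mem, ← map_inv]
    simpa [mul_assoc] using h2

theorem card_smul_aut {G : Type u} [Group G] (φ : MulAut G) (K : Subgroup G) :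
    Nat.card (φ • K : Subgroup G) = Nat.card K :=
  Nat.card_congr (Subgroup.equivSMul φ K).toEquiv.symm

theorem orbitMark_eq_of_card {G : Type u} [Group G] [Finite G] {L K L' K' : Subgroup G}
    (hK : Nat.card K' = Nat.card K)
    (h : Nat.card {x : G // L' ≤ MulAut.conj x • K'} = Nat.card {x : G // L ≤ MulAut.conj x • K}) :
    orbitMark L' K' = orbitMark L K := by
  have h1 := card_conj_le L K
  have h2 := card_conj_le L' K'
  rw [h, h1, hK] at h2
  have h3 : (Nat.card K : ℚ) ≠ 0 := Nat.cast_ne_zero.2 Nat.card_pos.ne'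
  exact (mul_right_cancel₀ h3 h2).symm

theorem orbitMark_aut {G : Type u} [Group G] [Finite G] (φ : MulAut G) (L K : Subgroup G) :
    orbitMark (φ • L) (φ • K) = orbitMark L K := by
  refine orbitMark_eq_of_card (card_smul_aut φ K) (Nat.card_congr ?_)
  refine (Equiv.subtypeEquiv φ.toEquiv ?_).symm
  intro x
  change _ ↔ φ • L ≤ MulAut.conj (φ x) • (φ • K)
  rw [← smul_conj_aut, Subgroup.pointwise_smul_le_pointwise_smul_iff]

theorem orbitMark_conj_right {G : Type u} [Group G] [Finite G] (g : G) (L K : Subgroup G) :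
    orbitMark L (MulAut.conj g • K) = orbitMark L K := by
  refine orbitMark_eq_of_card (card_smul_aut _ K) (Nat.card_congr ?_)
  refine Equiv.subtypeEquiv (Equiv.mulRight g) ?_
  intro x
  simp [mul_smul]

theorem orbitMark_conj_left {G : Type u} [Group G] [Finite G] (g : G) (L K : Subgroup G) :
    orbitMark (MulAut.conj g • L) K = orbitMark L K := by
  rw [← orbitMark_conj_right g, orbitMark_aut]

/-- The mark `|(G/K)^L|` as a function of the conjugacy classes `(L)` and `(K)`. -/
def classMark {G : Type u} [Group G] [Finite G] (c d : SubgroupConjClass G) : ℚ :=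
  Quotient.liftOn₂ c d orbitMark (by
    rintro L K _ _ ⟨g, rfl⟩ ⟨h, rfl⟩
    rw [orbitMark_conj_left, orbitMark_conj_right])

/-- The underlying `ℚ`-vector space of the rational Burnside ring `A_ℚ(G)` (the rational
Grothendieck ring of finite `G`-sets), given by its additive basis: the classes `[G/K]` of transitive `G`-sets, one for each
conjugacy class `(K)` of subgroups of `G`. -/
abbrev RationalBurnside (G : Type u) [Group G] : Type u := SubgroupConjClass G →₀ ℚ

/-- The linear map `A_ℚ(G) → ∏_{(L)} ℚ` that sends a finite `G`-set `T` to `(L) ↦ |T^L|`. -/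
def burnsideMarks (G : Type u) [Group G] [Finite G] :
    RationalBurnside G →ₗ[ℚ] (SubgroupConjClass G → ℚ) :=
  Finsupp.linearCombination ℚ (fun d c => classMark c d)

theorem burnsideMarks_apply {G : Type u} [Group G] [Finite G] (a : RationalBurnside G)
    (c : SubgroupConjClass G) :
    burnsideMarks G a c = a.sum (fun d q => q * classMark c d) := by
  simp [burnsideMarks, Finsupp.linearCombination_apply, Finsupp.sum, Finset.sum_apply]

theorem orbitMark_self_ne_zero {G : Type u} [Group G] [Finite G] (K : Subgroup G) :
    orbitMark K K ≠ 0 := by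
  intro h
  have h1 := card_conj_le K K
  rw [h, zero_mul, Nat.cast_eq_zero] at h1
  have : Nonempty {x : G // K ≤ MulAut.conj x • K} := ⟨⟨1, by simp⟩⟩
  exact Nat.card_pos.ne' h1

theorem exists_conj_le_of_orbitMark_ne_zero {G : Type u} [Group G] [Finite G] {L K : Subgroup G}
    (h : orbitMark L K ≠ 0) : ∃ x : G, L ≤ MulAut.conj x • K := by
  by_contra hx
  have h1 := card_conj_le L K
  have : IsEmpty {x : G // L ≤ MulAut.conj x • K} := ⟨fun x => hx ⟨x.1, x.2⟩⟩
  rw [Nat.card_of_isEmpty, Nat.cast_zero] at h1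
  rcases mul_eq_zero.1 h1.symm with h2 | h2
  · exact h h2
  · exact Nat.card_pos.ne' (Nat.cast_eq_zero.1 h2)

/-- The common order of the subgroups in a conjugacy class. -/
def SubgroupConjClass.order {G : Type u} [Group G] (c : SubgroupConjClass G) : ℕ :=
  Quotient.liftOn c (fun K => Nat.card K) (by
    rintro K _ ⟨g, rfl⟩
    exact (card_smul_aut _ K).symm)

theorem eq_of_classMark_ne_zero {G : Type u} [Group G] [Finite G] {c d : SubgroupConjClass G}
    (h : classMark c d ≠ 0) (hcd : d.order ≤ c.order) : c = d := by
  induction c using Quotient.inductionOn with | _ L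
  induction d using Quotient.inductionOn with | _ K
  obtain ⟨x, hx⟩ := exists_conj_le_of_orbitMark_ne_zero (L := L) (K := K) h
  have h1 : Nat.card (MulAut.conj x • K : Subgroup G) ≤ Nat.card L := by
    rw [card_smul_aut]; exact hcd
  have h2 : L = MulAut.conj x • K := Subgroup.eq_of_le_of_card_ge hx h1
  exact (Quotient.sound ⟨x, h2.symm⟩ : SubgroupConjClass.mk K = SubgroupConjClass.mk L).symm

theorem burnsideMarks_injective (G : Type u) [Group G] [Finite G] :
    Function.Injective (burnsideMarks G) := by
  rw [← LinearMap.ker_eq_bot, LinearMap.ker_eq_bot']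
  intro a ha
  by_contra hne
  obtain ⟨c, hc, hmax⟩ := a.support.exists_max_image SubgroupConjClass.order
    (Finsupp.support_nonempty_iff.2 hne)
  have h1 := congrFun ha c
  rw [burnsideMarks_apply, Finsupp.sum, Finset.sum_eq_single c] at h1
  · rcases mul_eq_zero.1 h1 with h2 | h2
    · exact (Finsupp.mem_support_iff.1 hc) h2
    · revert h2
      induction c using Quotient.inductionOn with | _ L
      exact orbitMark_self_ne_zero L
  · intro d hd hdc
    by_contra h2
    exact hdc (eq_of_classMark_ne_zero (right_ne_zero_of_mul h2) (hmax d hd)).symm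
  · intro h; exact absurd hc h

/-- The isomorphism `A_ℚ(G) ≅ ∏_{(L)} ℚ` given by the marks. -/
def burnsideIso (G : Type u) [Group G] [Finite G] :
    RationalBurnside G ≃ₗ[ℚ] (SubgroupConjClass G → ℚ) :=
  LinearEquiv.ofBijective (burnsideMarks G) (by
    refine ⟨burnsideMarks_injective G, ?_⟩
    have : Fintype (SubgroupConjClass G) := Fintype.ofFinite _
    refine (LinearMap.injective_iff_surjective_of_finrank_eq_finrank ?_).1
      (burnsideMarks_injective G)
    simp)

open Classical in
/-- The idempotent `e_H^G ∈ A_ℚ(G)`: the element that corresponds to the characteristic function of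
the conjugacy class `(H)` under `A_ℚ(G) ≅ ∏_{(L)} ℚ`. -/
def burnsideIdempotent {G : Type u} [Group G] [Finite G] (H : Subgroup G) : RationalBurnside G :=
  (burnsideIso G).symm (Pi.single (SubgroupConjClass.mk H) 1)

/-- The action of an automorphism of `G` on the conjugacy classes of subgroups. -/
def SubgroupConjClass.aut {G : Type u} [Group G] (φ : MulAut G) (c : SubgroupConjClass G) :
    SubgroupConjClass G :=
  Quotient.map (fun K : Subgroup G => φ • K) (by
    rintro K _ ⟨g, rfl⟩
    exact ⟨φ g, (smul_conj_aut φ g K).symm⟩) c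

theorem burnsideMarks_aut {G : Type u} [Group G] [Finite G] (φ : MulAut G)
    (a : RationalBurnside G) (c : SubgroupConjClass G) :
    burnsideMarks G (a.mapDomain (SubgroupConjClass.aut φ)) (SubgroupConjClass.aut φ c) =
      burnsideMarks G a c := by
  rw [burnsideMarks_apply, burnsideMarks_apply, Finsupp.sum_mapDomain_index]
  · refine Finsupp.sum_congr fun d _ => ?_
    congr 1
    induction c using Quotient.inductionOn with | _ L
    induction d using Quotient.inductionOn with | _ K
    exact orbitMark_aut φ L K
  · simp
  · intros; ring

theorem burnsideIdempotent_top_aut {G : Type u} [Group G] [Finite G] (φ : MulAut G) :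
    (burnsideIdempotent (⊤ : Subgroup G)).mapDomain (SubgroupConjClass.aut φ) =
      burnsideIdempotent (⊤ : Subgroup G) := by
  classical
  have htop (ψ : MulAut G) : SubgroupConjClass.aut ψ (SubgroupConjClass.mk ⊤) = SubgroupConjClass.mk ⊤ := by
    change SubgroupConjClass.mk (ψ • ⊤) = _
    congr 1
    rw [eq_top_iff]
    intro x _
    rw [Subgroup.mem_pointwise_smul_iff_inv_smul_mem]
    trivial
  have hmarks (c : SubgroupConjClass G) : burnsideMarks G (burnsideIdempotent (⊤ : Subgroup G)) c =
      (Pi.single (SubgroupConjClass.mk ⊤) 1 : SubgroupConjClass G → ℚ) c :=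
    congrFun ((burnsideIso G).apply_symm_apply _) c
  apply burnsideMarks_injective G
  funext c
  have hc : SubgroupConjClass.aut φ (SubgroupConjClass.aut φ⁻¹ c) = c := by
    induction c using Quotient.inductionOn with | _ L
    change SubgroupConjClass.mk (φ • φ⁻¹ • L) = _
    rw [smul_inv_smul]
  rw [← hc, burnsideMarks_aut, hmarks, hc, hmarks]
  by_cases h : c = SubgroupConjClass.mk ⊤
  · rw [h, htop]
  · rw [Pi.single_eq_of_ne h, Pi.single_eq_of_ne]
    intro h1
    apply h
    rw [← hc, h1, htop]

/-! ### Rational Mackey functors -/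

theorem conj_inf_eq {G : Type u} [Group G] (x : G) (K L : Subgroup G) :
    MulAut.conj x • (L ⊓ MulAut.conj x⁻¹ • K) = K ⊓ MulAut.conj x • L := by
  rw [Subgroup.smul_inf, map_inv, smul_inv_smul, inf_comm]

theorem map_subtype_smul {G : Type u} [Group G] (H : Subgroup G) (φ : MulAut H) (g : G)
    (hφ : ∀ x : H, (φ x : G) = g * x * g⁻¹) (K : Subgroup H) :
    MulAut.conj g • K.map H.subtype = (φ • K).map H.subtype := by
  apply SetLike.coe_injective
  change (fun x : G => MulAut.conj g x) '' ((fun x : H => (x : G)) '' (K : Set H)) =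
    (fun x : H => (x : G)) '' ((fun x : H => φ x) '' (K : Set H))
  rw [Set.image_image, Set.image_image]
  exact Set.image_congr fun x _ => (hφ x).symm

/-- A rational `G`-Mackey functor. The value `M(G/H)` is `M.obj H`. The conjugation map
`C_g : M(G/H) → M(G/gHg⁻¹)` is `M.conj g h : M.obj H → M.obj H'`, where `h : g H g⁻¹ = H'`.
In the Mackey axiom `T` runs over all sets of representatives of the double cosets `K\H/L`. -/
structure MackeyFunctor (G : Type u) [Group G] where
  obj : Subgroup G → Type v
  [addCommGroup : ∀ H, AddCommGroup (obj H)]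
  [module : ∀ H, Module ℚ (obj H)]
  res : ∀ {K H : Subgroup G}, K ≤ H → obj H →ₗ[ℚ] obj K
  ind : ∀ {K H : Subgroup G}, K ≤ H → obj K →ₗ[ℚ] obj H
  conj : ∀ (g : G) {H H' : Subgroup G}, MulAut.conj g • H = H' → obj H →ₗ[ℚ] obj H'
  res_refl : ∀ H : Subgroup G, res (le_refl H) = LinearMap.id
  ind_refl : ∀ H : Subgroup G, ind (le_refl H) = LinearMap.id
  conj_of_mem : ∀ (H : Subgroup G) (h : G), h ∈ H → ∀ e : MulAut.conj h • H = H,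
    conj h e = LinearMap.id
  ind_trans : ∀ {L K H : Subgroup G} (hLK : L ≤ K) (hKH : K ≤ H),
    ind (hLK.trans hKH) = ind hKH ∘ₗ ind hLK
  res_trans : ∀ {L K H : Subgroup G} (hLK : L ≤ K) (hKH : K ≤ H),
    res (hLK.trans hKH) = res hLK ∘ₗ res hKH
  conj_mul : ∀ (g h : G) {H H' H'' : Subgroup G} (e : MulAut.conj h • H = H')
    (e' : MulAut.conj g • H' = H'') (e'' : MulAut.conj (g * h) • H = H''),
    conj (g * h) e'' = conj g e' ∘ₗ conj h e
  res_conj : ∀ (g : G) {K H K' H' : Subgroup G} (hKH : K ≤ H) (hKH' : K' ≤ H')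
    (eK : MulAut.conj g • K = K') (eH : MulAut.conj g • H = H'),
    res hKH' ∘ₗ conj g eH = conj g eK ∘ₗ res hKH
  ind_conj : ∀ (g : G) {K H K' H' : Subgroup G} (hKH : K ≤ H) (hKH' : K' ≤ H')
    (eK : MulAut.conj g • K = K') (eH : MulAut.conj g • H = H'),
    ind hKH' ∘ₗ conj g eK = conj g eH ∘ₗ ind hKH
  mackey : ∀ {K L H : Subgroup G} (hK : K ≤ H) (hL : L ≤ H) (T : Finset G),
    (∀ x ∈ T, x ∈ H) →
    (∀ h ∈ H, ∃! x : G, x ∈ T ∧ h ∈ DoubleCoset.doubleCoset x (K : Set G) (L : Set G)) →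
    res hK ∘ₗ ind hL = ∑ x ∈ T,
      ind (inf_le_left : K ⊓ MulAut.conj x • L ≤ K) ∘ₗ
        conj x (conj_inf_eq x K L) ∘ₗ
          res (inf_le_left : L ⊓ MulAut.conj x⁻¹ • K ≤ L)

namespace MackeyFunctor

attribute [instance] MackeyFunctor.addCommGroup MackeyFunctor.module

section Category

variable {G : Type u} [Group G]

/-- A morphism of Mackey functors: linear maps `M(G/H) → N(G/H)` that commute with restriction,
induction and conjugation. -/
@[ext]
structure Hom (M N : MackeyFunctor.{u, v} G) where
  app : ∀ H : Subgroup G, M.obj H →ₗ[ℚ] N.obj H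
  app_res : ∀ {K H : Subgroup G} (h : K ≤ H), app K ∘ₗ M.res h = N.res h ∘ₗ app H
  app_ind : ∀ {K H : Subgroup G} (h : K ≤ H), app H ∘ₗ M.ind h = N.ind h ∘ₗ app K
  app_conj : ∀ (g : G) {H H' : Subgroup G} (e : MulAut.conj g • H = H'),
    app H' ∘ₗ M.conj g e = N.conj g e ∘ₗ app H

/-- The category of rational `G`-Mackey functors. -/
instance : Category (MackeyFunctor.{u, v} G) where
  Hom := Hom
  id M :=
    { app := fun _ => LinearMap.id
      app_res := fun _ => rfl
      app_ind := fun _ => rfl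
      app_conj := fun _ _ _ _ => rfl }
  comp f g :=
    { app := fun H => g.app H ∘ₗ f.app H
      app_res := fun h => by
        rw [LinearMap.comp_assoc, f.app_res, ← LinearMap.comp_assoc, g.app_res,
          LinearMap.comp_assoc]
      app_ind := fun h => by
        rw [LinearMap.comp_assoc, f.app_ind, ← LinearMap.comp_assoc, g.app_ind,
          LinearMap.comp_assoc]
      app_conj := fun x _ _ e => by
        rw [LinearMap.comp_assoc, f.app_conj, ← LinearMap.comp_assoc, g.app_conj,
          LinearMap.comp_assoc] }

end Category

section Weyl

variable {G : Type u} [Group G] (M : MackeyFunctor.{u, v} G)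

/-- The operator `I_K^H ∘ R_K^H` on `M(G/H)`, for a subgroup `K` of the group `H`. -/
def indRes (H : Subgroup G) (K : Subgroup H) : Module.End ℚ (M.obj H) :=
  M.ind (Subgroup.map_subtype_le K) ∘ₗ M.res (Subgroup.map_subtype_le K)

theorem conj_indRes (H : Subgroup G) (K K' : Subgroup H) (g : G) (e : MulAut.conj g • H = H)
    (eK : MulAut.conj g • K.map H.subtype = K'.map H.subtype) :
    M.indRes H K' ∘ₗ M.conj g e = M.conj g e ∘ₗ M.indRes H K := by
  unfold indRes
  rw [LinearMap.comp_assoc, M.res_conj g (Subgroup.map_subtype_le K) _ eK e,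
    ← LinearMap.comp_assoc, M.ind_conj g (Subgroup.map_subtype_le K) _ eK e,
    LinearMap.comp_assoc]

/-- Inner automorphisms of `H` do not change `I_K^H ∘ R_K^H`. -/
theorem indRes_conj (H : Subgroup G) (h : H) (K : Subgroup H) :
    M.indRes H (MulAut.conj h • K) = M.indRes H K := by
  have e : MulAut.conj (h : G) • H = H :=
    Subgroup.mem_normalizer_iff_map_conj_eq.1 (Subgroup.le_normalizer h.2)
  have h1 := M.conj_indRes H K (MulAut.conj h • K) (h : G) e
    (map_subtype_smul H (MulAut.conj h) h (fun _ => rfl) K)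
  rw [M.conj_of_mem H h h.2 e, LinearMap.comp_id, LinearMap.id_comp] at h1
  exact h1

/-- The action of the rational Burnside ring `A_ℚ(H)` on `M(G/H)`: the linear extension of
`[H/K] ↦ I_K^H ∘ R_K^H`. -/
def burnsideAction (H : Subgroup G) : RationalBurnside H →ₗ[ℚ] Module.End ℚ (M.obj H) :=
  Finsupp.linearCombination ℚ (fun c : SubgroupConjClass H =>
    Quotient.liftOn c (M.indRes H) (by
      rintro K _ ⟨h, rfl⟩
      exact (M.indRes_conj H h K).symm))

/-- The subspace `e_H^H M(G/H)` of `M(G/H)`. -/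
def topPart [Finite G] (H : Subgroup G) : Submodule ℚ (M.obj H) :=
  LinearMap.range (M.burnsideAction H (burnsideIdempotent (⊤ : Subgroup H)))

theorem conj_eq_of_mem_normalizer {H : Subgroup G} (n : Subgroup.normalizer (H : Set G)) :
    MulAut.conj (n : G) • H = H :=
  Subgroup.mem_normalizer_iff_map_conj_eq.1 n.2

theorem conj_burnsideAction (H : Subgroup G) (n : Subgroup.normalizer (H : Set G))
    (a : RationalBurnside H) :
    M.burnsideAction H (a.mapDomain (SubgroupConjClass.aut (H.normalizerMonoidHom n))) ∘ₗ
        M.conj n (conj_eq_of_mem_normalizer n) =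
      M.conj n (conj_eq_of_mem_normalizer n) ∘ₗ M.burnsideAction H a := by
  induction a using Finsupp.induction_linear with
  | zero => simp
  | add a b ha hb =>
    rw [Finsupp.mapDomain_add, map_add, map_add, LinearMap.add_comp, LinearMap.comp_add, ha, hb]
  | single c q =>
    rw [Finsupp.mapDomain_single]
    unfold burnsideAction
    rw [Finsupp.linearCombination_single, Finsupp.linearCombination_single, LinearMap.smul_comp,
      LinearMap.comp_smul]
    congr 1
    induction c using Quotient.inductionOn with | _ K
    exact M.conj_indRes H K (H.normalizerMonoidHom n • K) n _
      (map_subtype_smul H _ n (fun _ => rfl) K)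

/-- The representation of `N_G H` on `M(G/H)` by the conjugation maps. -/
def normalizerRep (H : Subgroup G) :
    Representation ℚ (Subgroup.normalizer (H : Set G)) (M.obj H) where
  toFun n := M.conj n (conj_eq_of_mem_normalizer n)
  map_one' := M.conj_of_mem H 1 H.one_mem _
  map_mul' m n := M.conj_mul m n _ _ _

/-- The representation of `W_G H` on `M(G/H)`: the class of `n ∈ N_G H` acts by `C_n`. -/
def weylRep (H : Subgroup G) : Representation ℚ (WeylGroup H) (M.obj H) :=
  QuotientGroup.lift _ (M.normalizerRep H) (fun n hn =>
    M.conj_of_mem H n (Subgroup.mem_subgroupOf.1 hn) _)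

theorem topPart_le_comap [Finite G] (H : Subgroup G) (w : WeylGroup H) :
    M.topPart H ≤ (M.topPart H).comap (M.weylRep H w) := by
  induction w using QuotientGroup.induction_on with | _ n
  rintro _ ⟨x, rfl⟩
  refine ⟨M.conj n (conj_eq_of_mem_normalizer n) x, ?_⟩
  have h := M.conj_burnsideAction H n (burnsideIdempotent ⊤)
  rw [burnsideIdempotent_top_aut] at h
  exact LinearMap.congr_fun h x

/-- The `ℚ[W_G H]`-module `e_H^H M(G/H)`. -/
abbrev topModule [Finite G] (H : Subgroup G) : Type v :=
  ((M.weylRep H).subrepresentation (M.topPart H) (M.topPart_le_comap H)).asModule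

end Weyl

end MackeyFunctor

end

noncomputable section

open scoped Classical

attribute [local instance 2000] Fintype.ofFinite

/-! ### Sums over double cosets -/

/-! Write `e_H` for the operator `topProj H` given by the idempotent e_H^H. The proof rests on three
properties of `e_H`: proper restrictions vanish on its image (`res_comp_topProj`), it kills
everything induced from proper subgroups (`topProj_comp_ind`), and it differs from the identity only
by multiples of I_J R_J with J proper (`exists_topProj_eq_add`). For the first two, Gluck's formula
expresses `e_H` through the Möbius function of the subgroup lattice. The Mackey formula then reduces
the claim to Weisner's theorem: Möbius values summed over {J : L ∩ J = Q} cancel when L is proper.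

It follows by induction on H that m ∈ M(G/H) is determined by its coordinates `e_K R_K m`, K ≤ H
(`eq_zero_of_topProj_res_eq_zero`). A conjugation-equivariant family of maps `f_K` between the top
parts extends to all values by `∑_K (|K|/|H|) I_K f_K R_K`. The L-th coordinate of this sum is `f_L
R_L` (`topProj_res_extend`), so compatibility with restriction, induction and conjugation, as well
as inverses, can be checked on coordinates. Hence the top parts with their conjugation maps
determine the functor.

An equivariant family amounts to a W_G H-linear map for one H in each conjugacy class, transported
to the other subgroups by conjugation (`transport_comp_conj`). Conversely, a morphism commutes with
every `e_H`, so an isomorphism restricts to the top parts. -/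

/-- If h = kxl, then (a, b) ↦ ka⁻¹ identifies the factorizations h = axb with K ∩ hLh⁻¹. This count
is what turns a sum over representatives into a sum over all of H. -/
theorem card_doubleCoset_fiber {G : Type u} [Group G] (K L : Subgroup G) {x h : G}
    (hx : h ∈ DoubleCoset.doubleCoset x (K : Set G) (L : Set G)) :
    Nat.card {p : K × L // (p.1 : G) * x * p.2 = h} =
      Nat.card (K ⊓ MulAut.conj h • L : Subgroup G) := by
  obtain ⟨k, hk, l, hl, rfl⟩ := DoubleCoset.mem_doubleCoset.1 hx
  refine Nat.card_congr
    { toFun := fun p => ⟨k * (p.1.1 : G)⁻¹, K.mul_mem hk (K.inv_mem p.1.1.2), ?_⟩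
      invFun := fun u => ⟨(⟨(u : G)⁻¹ * k, K.mul_mem (K.inv_mem u.2.1) hk⟩,
        ⟨x⁻¹ * k⁻¹ * u * k * x * l, ?_⟩), ?_⟩
      left_inv := ?_
      right_inv := ?_ }
  · have h := p.2
    have h1 : (p.1.2 : G) = x⁻¹ * (p.1.1 : G)⁻¹ * (k * x * l) :=
        (eq_inv_mul_of_mul_eq (eq_inv_mul_of_mul_eq ((mul_assoc _ _ _).symm.trans h))).trans
          (mul_assoc _ _ _).symm
    have h2 := L.mul_mem (L.inv_mem hl) p.1.2.2
    change k * (p.1.1 : G)⁻¹ ∈ MulAut.conj (k * x * l) • L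
    rw [Subgroup.mem_pointwise_smul_iff_inv_smul_mem, ← map_inv]
    rw [h1] at h2
    simpa [mul_assoc] using h2
  · have h := u.2.2
    change (u : G) ∈ MulAut.conj (k * x * l) • L at h
    rw [Subgroup.mem_pointwise_smul_iff_inv_smul_mem, ← map_inv] at h
    have h2 := L.mul_mem hl h
    simpa [mul_assoc] using h2
  · simp [mul_assoc]
  · rintro ⟨⟨a, b⟩, h⟩
    apply Subtype.ext
    apply Prod.ext
    · apply Subtype.ext
      simp
    · apply Subtype.ext
      have h1 : (b : G) = x⁻¹ * (a : G)⁻¹ * (k * x * l) :=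
        (eq_inv_mul_of_mul_eq (eq_inv_mul_of_mul_eq ((mul_assoc _ _ _).symm.trans h))).trans
          (mul_assoc _ _ _).symm
      rw [h1]
      simp [mul_assoc]
  · rintro ⟨u, hu⟩
    apply Subtype.ext
    simp

/-- The sum of a function over representatives of `K\H/L`, as a weighted sum over `H`. -/
theorem sum_doubleCoset_reps {G : Type u} [Group G] [Finite G] {V : Type*} [AddCommGroup V]
    [Module ℚ V] {K L H : Subgroup G} (hK : K ≤ H) (hL : L ≤ H) (T : Finset G)
    (hTH : ∀ x ∈ T, x ∈ H)
    (hT : ∀ h ∈ H, ∃! x : G, x ∈ T ∧ h ∈ DoubleCoset.doubleCoset x (K : Set G) (L : Set G))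
    (f : G → V) (hf : ∀ k ∈ K, ∀ x, ∀ l ∈ L, f (k * x * l) = f x) :
    ∑ x ∈ T, f x = ∑ h : H,
      ((Nat.card (K ⊓ MulAut.conj (h : G) • L : Subgroup G) : ℚ) / (Nat.card K * Nat.card L)) •
        f h := by
  have hKL : (Nat.card K : ℚ) * Nat.card L ≠ 0 :=
    mul_ne_zero (Nat.cast_ne_zero.2 Nat.card_pos.ne') (Nat.cast_ne_zero.2 Nat.card_pos.ne')
  -- Since f is constant on double cosets, f x may be replaced by its values at all kxl. Regrouping
  -- by h = kxl counts each h exactly |K ∩ hLh⁻¹| times.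
  have h1 : ((Nat.card K : ℚ) * Nat.card L) • ∑ x ∈ T, f x =
      ∑ x ∈ T, ∑ p : K × L, f (p.1 * x * p.2) := by
    rw [Finset.smul_sum]
    refine Finset.sum_congr rfl fun x _ => ?_
    rw [Finset.sum_congr rfl fun (p : K × L) _ => hf _ p.1.2 x _ p.2.2, Finset.sum_const,
      Finset.card_univ, ← Nat.card_eq_fintype_card, Nat.card_prod, ← Nat.cast_mul,
      Nat.cast_smul_eq_nsmul]
  have h2 : ∑ x ∈ T, ∑ p : K × L, f (p.1 * x * p.2) =
      ∑ h : H, (Nat.card (K ⊓ MulAut.conj (h : G) • L : Subgroup G) : ℚ) • f h := by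
    have h3 : ∀ x ∈ T, ∑ p : K × L, f (p.1 * x * p.2) =
        ∑ h : H, ∑ p : K × L, if (p.1 : G) * x * p.2 = h then f h else 0 := by
      intro x hx
      rw [Finset.sum_comm]
      refine Finset.sum_congr rfl fun p _ => ?_
      rw [Finset.sum_eq_single
        (⟨p.1 * x * p.2, H.mul_mem (H.mul_mem (hK p.1.2) (hTH x hx)) (hL p.2.2)⟩ : H)]
      · simp
      · intro b _ hb
        rw [if_neg]
        intro h
        exact hb (Subtype.ext h.symm)
      · simp
    rw [Finset.sum_congr rfl h3, Finset.sum_comm]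
    refine Finset.sum_congr rfl fun h _ => ?_
    obtain ⟨x, ⟨hxT, hx⟩, huniq⟩ := hT h h.2
    rw [Finset.sum_eq_single x]
    · rw [← card_doubleCoset_fiber K L hx, ← Finset.sum_filter, Finset.sum_const,
        Nat.cast_smul_eq_nsmul, Nat.card_eq_fintype_card, Fintype.card_subtype]
    · intro y hy hyx
      refine Finset.sum_eq_zero fun p _ => if_neg fun hp => hyx (huniq y ⟨hy, ?_⟩)
      exact DoubleCoset.mem_doubleCoset.2 ⟨_, p.1.2, _, p.2.2, hp.symm⟩
    · exact fun h => absurd hxT h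
  rw [← inv_smul_smul₀ hKL (∑ x ∈ T, f x), h1, h2, Finset.smul_sum]
  refine Finset.sum_congr rfl fun h _ => ?_
  rw [smul_smul, div_eq_inv_mul]

theorem exists_doubleCoset_reps {G : Type u} [Group G] [Finite G] {K L H : Subgroup G}
    (hK : K ≤ H) (hL : L ≤ H) : ∃ T : Finset G, (∀ x ∈ T, x ∈ H) ∧
      ∀ h ∈ H, ∃! x : G, x ∈ T ∧ h ∈ DoubleCoset.doubleCoset x (K : Set G) (L : Set G) := by
  refine ⟨Finset.univ.image fun h : H => (DoubleCoset.mk K L (h : G)).out, ?_, ?_⟩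
  · intro x hx
    obtain ⟨h, -, rfl⟩ := Finset.mem_image.1 hx
    obtain ⟨k, l, hk, hl, e⟩ := DoubleCoset.mk_out_eq_mul K L (h : G)
    rw [e]
    exact H.mul_mem (H.mul_mem (hK hk) h.2) (hL hl)
  · intro h hh
    refine ⟨(DoubleCoset.mk K L h).out, ⟨Finset.mem_image.2 ⟨⟨h, hh⟩, Finset.mem_univ _, rfl⟩, ?_⟩,
      ?_⟩
    · rw [DoubleCoset.mem_doubleCoset]
      have := (DoubleCoset.eq K L (DoubleCoset.mk K L h).out h).1 (DoubleCoset.out_eq' _ _ _)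
      obtain ⟨a, ha, b, hb, e⟩ := this
      exact ⟨a, ha, b, hb, e⟩
    · rintro y ⟨hy, hhy⟩
      obtain ⟨h', -, rfl⟩ := Finset.mem_image.1 hy
      obtain ⟨a, ha, b, hb, e⟩ := DoubleCoset.mem_doubleCoset.1 hhy
      have h1 := (DoubleCoset.eq K L _ h).2 ⟨a, ha, b, hb, e⟩
      rw [DoubleCoset.out_eq'] at h1
      rw [h1]

theorem conj_smul_self_of_mem {G : Type u} [Group G] {K : Subgroup G} {k : G} (hk : k ∈ K) :
    MulAut.conj k • K = K :=
  Subgroup.mem_normalizer_iff_map_conj_eq.1 (Subgroup.le_normalizer hk)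

namespace MackeyFunctor

variable {G : Type u} [Group G] (M : MackeyFunctor.{u, v} G)

/-- The composite `I_A^K C_x R^L_B`, where `x B x⁻¹ = A`, does not change when `x` is moved in its
double coset in `K\G/L`. -/
theorem ind_conj_res_doubleCoset {K L A A' B B' : Subgroup G} {k x l : G} (hk : k ∈ K) (hl : l ∈ L)
    (hA : A ≤ K) (hA' : A' ≤ K) (hB : B ≤ L) (hB' : B' ≤ L) (e : MulAut.conj x • B = A)
    (e' : MulAut.conj (k * x * l) • B' = A') (eA : MulAut.conj k • A = A')
    (eB : MulAut.conj l • B' = B) :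
    M.ind hA' ∘ₗ M.conj (k * x * l) e' ∘ₗ M.res hB' = M.ind hA ∘ₗ M.conj x e ∘ₗ M.res hB := by
  have eK := conj_smul_self_of_mem hk
  have eL := conj_smul_self_of_mem hl
  have e1 : MulAut.conj (k * x) • B = A' := by rw [map_mul, mul_smul, e, eA]
  have h1 := M.ind_conj k hA hA' eA eK
  have h2 := M.res_conj l hB' hB eB eL
  rw [M.conj_of_mem K k hk, LinearMap.id_comp] at h1
  rw [M.conj_of_mem L l hl, LinearMap.comp_id] at h2
  rw [M.conj_mul (k * x) l eB e1 e', M.conj_mul k x e eA e1, LinearMap.comp_assoc,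
    LinearMap.comp_assoc, ← h2, ← LinearMap.comp_assoc, h1]

/-- The map `I^K_{K ∩ xLx⁻¹} C_x R^L_{L ∩ x⁻¹Kx}` of the Mackey formula. -/
def mackeyTerm (K L : Subgroup G) (x : G) : M.obj L →ₗ[ℚ] M.obj K :=
  M.ind (inf_le_left : K ⊓ MulAut.conj x • L ≤ K) ∘ₗ M.conj x (conj_inf_eq x K L) ∘ₗ
    M.res (inf_le_left : L ⊓ MulAut.conj x⁻¹ • K ≤ L)

theorem mackeyTerm_doubleCoset (K L : Subgroup G) {k l : G} (hk : k ∈ K) (x : G) (hl : l ∈ L) :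
    M.mackeyTerm K L (k * x * l) = M.mackeyTerm K L x := by
  refine M.ind_conj_res_doubleCoset hk hl _ _ _ _ _ _ ?_ ?_
  · rw [Subgroup.smul_inf, conj_smul_self_of_mem hk, map_mul, map_mul, mul_smul, mul_smul,
      conj_smul_self_of_mem hl]
  · rw [Subgroup.smul_inf, conj_smul_self_of_mem hl, mul_inv_rev, mul_inv_rev, map_mul, mul_smul,
      map_mul, mul_smul, conj_smul_self_of_mem (K.inv_mem hk), map_inv, smul_inv_smul]

/-- The Mackey formula, as a weighted sum over all elements of `H`. -/
theorem res_comp_ind [Finite G] {K L H : Subgroup G} (hK : K ≤ H) (hL : L ≤ H) :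
    M.res hK ∘ₗ M.ind hL = ∑ h : H,
      ((Nat.card (K ⊓ MulAut.conj (h : G) • L : Subgroup G) : ℚ) / (Nat.card K * Nat.card L)) •
        M.mackeyTerm K L h := by
  obtain ⟨T, hTH, hT⟩ := exists_doubleCoset_reps hK hL
  rw [M.mackey hK hL T hTH hT]
  exact sum_doubleCoset_reps hK hL T hTH hT (M.mackeyTerm K L)
    fun k hk x l hl => M.mackeyTerm_doubleCoset K L hk x hl

end MackeyFunctor

/-! ### Möbius weights -/

theorem sum_weight_fiberwise {α β : Type*} [Finite α] [Finite β] {V : Type*} [AddCommGroup V]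
    [Module ℚ V] (p : α → β) (w : α → ℚ) (F : β → V) :
    ∑ b, (∑ a, if p a = b then w a else 0) • F b = ∑ a, w a • F (p a) := by
  simp_rw [Finset.sum_smul, ite_smul, zero_smul]
  rw [Finset.sum_comm]
  simp

/-- If `w` is the Möbius function `μ(·, ⊤)` of a finite meet-semilattice, then the values of `w` on
each fibre of `J ↦ L ⊓ J` have sum zero, for `L ≠ ⊤` (Weisner). -/
theorem sum_weight_smul_inf {α : Type*} [SemilatticeInf α] [OrderTop α] [Finite α] {V : Type*}
    [AddCommGroup V] [Module ℚ V] (w : α → ℚ)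
    (hw : ∀ P : α, (∑ J, if P ≤ J then w J else 0) = if P = ⊤ then 1 else 0) {L : α} (hL : L ≠ ⊤)
    (F : α → V) : ∑ J, w J • F (L ⊓ J) = 0 := by
  rw [← sum_weight_fiberwise (fun J => L ⊓ J) w F]
  refine Finset.sum_eq_zero fun Q _ => ?_
  suffices h : (∑ J, if L ⊓ J = Q then w J else 0) = 0 by rw [h, zero_smul]
  -- Downward induction on Q. For Q ≤ L, the conditions Q ≤ J and Q ≤ L ⊓ J agree, so the total
  -- weight above Q, which is zero, is the sum of the fibre weights over all P ≥ Q; those with P > Q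
  -- vanish by induction. If Q is not below L, the fibre is empty.
  induction Q using (wellFounded_gt (α := α)).induction with | _ Q ih
  by_cases hQ : Q ≤ L
  · have h1 := hw Q
    rw [if_neg fun h : Q = ⊤ => hL (top_le_iff.1 (h ▸ hQ))] at h1
    have h2 := sum_weight_fiberwise (fun J => L ⊓ J) w (fun P => if Q ≤ P then (1 : ℚ) else 0)
    rw [Finset.sum_eq_single Q] at h2
    · simpa [hQ, h1] using h2
    · intro P _ hPQ
      by_cases h : Q ≤ P
      · rw [ih P (lt_of_le_of_ne h hPQ.symm) (Finset.mem_univ _), zero_smul]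
      · rw [if_neg h, smul_zero]
    · simp
  · refine Finset.sum_eq_zero fun J _ => if_neg fun h : L ⊓ J = Q => hQ (h ▸ inf_le_left)

/-- The Möbius function `μ(J, G)` of the subgroup lattice, read off from the coefficients of the
idempotent `e_G^G`. -/
def mobiusWeight (G : Type u) [Group G] [Finite G] (J : Subgroup G) : ℚ :=
  ∑ p : SubgroupConjClass G × G, if MulAut.conj p.2 • p.1.out = J then
    burnsideIdempotent (⊤ : Subgroup G) p.1 / Nat.card p.1.out else 0

theorem sum_mobiusWeight_smul {G : Type u} [Group G] [Finite G] {V : Type*} [AddCommGroup V]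
    [Module ℚ V] (F : Subgroup G → V) :
    ∑ J, mobiusWeight G J • F J = ∑ d : SubgroupConjClass G, ∑ x : G,
      (burnsideIdempotent (⊤ : Subgroup G) d / Nat.card d.out) • F (MulAut.conj x • d.out) := by
  rw [← Fintype.sum_prod_type']
  exact (sum_weight_fiberwise
    (fun p : SubgroupConjClass G × G => MulAut.conj p.2 • p.1.out) _ F).trans
    (Finset.sum_congr (by ext; simp) fun _ _ => rfl)

theorem mk_eq_mk_top_iff {G : Type u} [Group G] (P : Subgroup G) :
    SubgroupConjClass.mk P = SubgroupConjClass.mk ⊤ ↔ P = ⊤ := by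
  refine ⟨fun h => ?_, fun h => h ▸ rfl⟩
  obtain ⟨g, hg⟩ := Quotient.exact h
  rw [eq_top_iff]
  intro x _
  have h1 : MulAut.conj g • x ∈ MulAut.conj g • P := by rw [hg]; trivial
  exact (Subgroup.smul_mem_pointwise_smul_iff).1 h1

/-- This is the recursion that defines μ(·, G). The left side is the mark of the idempotent at P,
because |(G/K)^P| is the number of x with P ≤ xKx⁻¹ divided by |K|. -/
theorem sum_mobiusWeight_ge {G : Type u} [Group G] [Finite G] (P : Subgroup G) :
    (∑ J, if P ≤ J then mobiusWeight G J else 0) = if P = ⊤ then 1 else 0 := by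
  have h1 := sum_mobiusWeight_smul (fun J : Subgroup G => if P ≤ J then (1 : ℚ) else 0)
  have h2 : burnsideMarks G (burnsideIdempotent (⊤ : Subgroup G)) (SubgroupConjClass.mk P) =
      (Pi.single (SubgroupConjClass.mk ⊤) 1 : SubgroupConjClass G → ℚ) (SubgroupConjClass.mk P) :=
    congrFun ((burnsideIso G).apply_symm_apply _) _
  simp_rw [smul_eq_mul, mul_ite, mul_one, mul_zero] at h1
  rw [h1]
  rw [Pi.single_apply, burnsideMarks_apply, Finsupp.sum_fintype _ _ (by simp)] at h2
  simp_rw [mk_eq_mk_top_iff] at h2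
  rw [← h2]
  refine Finset.sum_congr rfl fun d _ => ?_
  have h3 : classMark (SubgroupConjClass.mk P) d = orbitMark P d.out := by
    conv_lhs => rw [← Quotient.out_eq d]
    rfl
  have h4 := card_conj_le P d.out
  have h5 : (Nat.card d.out : ℚ) ≠ 0 := Nat.cast_ne_zero.2 Nat.card_pos.ne'
  rw [h3, ← Finset.sum_filter, Finset.sum_const, ← Fintype.card_subtype,
    ← Nat.card_eq_fintype_card, nsmul_eq_mul, h4]
  field_simp

theorem mobiusWeight_top (G : Type u) [Group G] [Finite G] : mobiusWeight G ⊤ = 1 := by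
  simpa using sum_mobiusWeight_ge (⊤ : Subgroup G)

theorem sum_mobiusWeight_conj_ge {G : Type u} [Group G] [Finite G] (φ : MulAut G)
    (P : Subgroup G) :
    (∑ J, if P ≤ J then mobiusWeight G (φ • J) else 0) = if P = ⊤ then 1 else 0 := by
  have h1 := sum_mobiusWeight_ge (φ • P)
  rw [← Equiv.sum_comp (MulAction.toPerm φ)] at h1
  have h2 : φ • P = ⊤ ↔ P = ⊤ := by
    have : φ • (⊤ : Subgroup G) = ⊤ := by
      rw [eq_top_iff]
      intro x _
      rw [Subgroup.mem_pointwise_smul_iff_inv_smul_mem]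
      trivial
    rw [← this, (MulAction.injective φ).eq_iff, this]
  simpa [h2] using h1

/-- Weisner's cancellation in the form that the Mackey formula needs, where J enters through a
conjugate. Automorphisms preserve the Möbius recursion, so J can be reindexed. -/
theorem sum_mobiusWeight_smul_inf {G : Type u} [Group G] [Finite G] {V : Type*} [AddCommGroup V]
    [Module ℚ V] (φ : MulAut G) {L : Subgroup G} (hL : L ≠ ⊤) (F : Subgroup G → V) :
    ∑ J, mobiusWeight G J • F (L ⊓ φ • J) = 0 := by
  rw [← Equiv.sum_comp (MulAction.toPerm φ⁻¹)]
  simpa using sum_weight_smul_inf _ (sum_mobiusWeight_conj_ge φ⁻¹) hL F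

namespace MackeyFunctor

variable {G : Type u} [Group G] [Finite G] (M : MackeyFunctor.{u, v} G)

/-- The action of the idempotent `e_H^H` on `M(G/H)`. -/
def topProj (H : Subgroup G) : Module.End ℚ (M.obj H) :=
  M.burnsideAction H (burnsideIdempotent (⊤ : Subgroup H))

/-- Gluck's formula for the action of `e_H^H`. -/
theorem topProj_eq_sum (H : Subgroup G) :
    M.topProj H = (Nat.card H : ℚ)⁻¹ •
      ∑ J : Subgroup H, mobiusWeight H J • (Nat.card J : ℚ) • M.indRes H J := by
  have hH : (Nat.card H : ℚ) ≠ 0 := Nat.cast_ne_zero.2 Nat.card_pos.ne'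
  rw [sum_mobiusWeight_smul, topProj, burnsideAction, Finsupp.linearCombination_apply,
    Finsupp.sum_fintype _ _ (by simp), Finset.smul_sum]
  refine Finset.sum_congr rfl fun d _ => ?_
  have h5 : (Nat.card d.out : ℚ) ≠ 0 := Nat.cast_ne_zero.2 Nat.card_pos.ne'
  -- All conjugates of a subgroup give the same operator, so the inner sum over H contributes a
  -- factor |H|, which cancels the normalization.
  simp_rw [M.indRes_conj, card_smul_aut]
  rw [Finset.sum_const, Finset.card_univ, ← Nat.card_eq_fintype_card,
    ← Nat.cast_smul_eq_nsmul ℚ, smul_smul, smul_smul, smul_smul]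
  have h6 : (Nat.card H : ℚ)⁻¹ * Nat.card H * (burnsideIdempotent (⊤ : Subgroup H) d /
      Nat.card d.out) * Nat.card d.out = burnsideIdempotent (⊤ : Subgroup H) d := by
    field_simp
  have h7 (F : Subgroup H → Module.End ℚ (M.obj H)) (hF) :
      Quotient.liftOn d F hF = F d.out := by
    conv_lhs => rw [← Quotient.out_eq d]
    rfl
  rw [h7, h6]

end MackeyFunctor

/-! ### The projection onto `e_H^H M(G/H)` -/

theorem map_subtype_subgroupOf_inf {G : Type u} [Group G] {L H : Subgroup G} (hL : L ≤ H) (h : H)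
    (J : Subgroup H) : (L.subgroupOf H ⊓ MulAut.conj h • J).map H.subtype =
      L ⊓ MulAut.conj (h : G) • J.map H.subtype := by
  rw [Subgroup.map_inf _ _ _ H.subtype_injective, Subgroup.subgroupOf_map_subtype,
    inf_eq_left.2 hL, map_subtype_smul H (MulAut.conj h) h (fun _ => rfl) J]

theorem subgroupOf_ne_top {G : Type u} [Group G] {L H : Subgroup G} (h : L < H) :
    L.subgroupOf H ≠ ⊤ :=
  fun h1 => h.not_ge (Subgroup.subgroupOf_eq_top.1 h1)

theorem map_subtype_top {G : Type u} [Group G] (H : Subgroup G) :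
    (⊤ : Subgroup H).map H.subtype = H := by
  rw [← MonoidHom.range_eq_map, Subgroup.range_subtype]

theorem map_subtype_lt {G : Type u} [Group G] {H : Subgroup G} {J : Subgroup H} (hJ : J ≠ ⊤) :
    J.map H.subtype < H :=
  lt_of_le_of_ne (Subgroup.map_subtype_le J) fun h => hJ <|
    Subgroup.map_injective H.subtype_injective (h.trans (map_subtype_top H).symm)

theorem conj_smul_inv_eq {G : Type u} [Group G] {g : G} {H H' : Subgroup G}
    (e : MulAut.conj g • H = H') : MulAut.conj g⁻¹ • H' = H := by
  rw [← e, map_inv, inv_smul_smul]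

theorem conj_smul_lt {G : Type u} [Group G] {g : G} {H H' K : Subgroup G}
    (e : MulAut.conj g • H = H') (h : K < H) : MulAut.conj g • K < H' := by
  subst e
  simpa [lt_iff_le_not_ge] using h

theorem card_map_subtype {G : Type u} [Group G] {H : Subgroup G} (J : Subgroup H) :
    Nat.card (J.map H.subtype) = Nat.card J :=
  Subgroup.card_map_of_injective H.subtype_injective

theorem linearMap_sum_comp {U V W ι : Type*} [AddCommGroup U] [Module ℚ U] [AddCommGroup V]
    [Module ℚ V] [AddCommGroup W] [Module ℚ W] (s : Finset ι) (f : ι → V →ₗ[ℚ] W) (g : U →ₗ[ℚ] V) :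
    (∑ i ∈ s, f i) ∘ₗ g = ∑ i ∈ s, f i ∘ₗ g := by
  ext; simp

theorem linearMap_comp_sum {U V W ι : Type*} [AddCommGroup U] [Module ℚ U] [AddCommGroup V]
    [Module ℚ V] [AddCommGroup W] [Module ℚ W] (s : Finset ι) (g : V →ₗ[ℚ] W) (f : ι → U →ₗ[ℚ] V) :
    (g ∘ₗ ∑ i ∈ s, f i) = ∑ i ∈ s, g ∘ₗ f i := by
  ext; simp

theorem natCard_ne_zero {G : Type u} [Group G] [Finite G] : (Nat.card G : ℚ) ≠ 0 :=
  Nat.cast_ne_zero.2 Nat.card_pos.ne'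

namespace MackeyFunctor

variable {G : Type u} [Group G] (M : MackeyFunctor.{u, v} G)

/-- The map `|A| I^K_A R^H_A` if `A` is contained in `H` and `K`, and zero otherwise. -/
def span (H K A : Subgroup G) : M.obj H →ₗ[ℚ] M.obj K :=
  if h : A ≤ H ∧ A ≤ K then (Nat.card A : ℚ) • M.ind h.2 ∘ₗ M.res h.1 else 0

theorem span_of_le {H K A : Subgroup G} (hH : A ≤ H) (hK : A ≤ K) :
    M.span H K A = (Nat.card A : ℚ) • M.ind hK ∘ₗ M.res hH :=
  dif_pos ⟨hH, hK⟩

/-- The conjugation disappears because C_x is the identity on M(G/H) for x ∈ H. -/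
theorem mackeyTerm_comp_res {K L H : Subgroup G} (hK : K ≤ H) (hL : L ≤ H) {x : G} (hx : x ∈ H) :
    M.mackeyTerm K L x ∘ₗ M.res hL = M.ind (inf_le_left : K ⊓ MulAut.conj x • L ≤ K) ∘ₗ
      M.res (inf_le_left.trans hK) := by
  have h := M.res_conj x (inf_le_left.trans hL) (inf_le_left.trans hK) (conj_inf_eq x K L)
    (conj_smul_self_of_mem hx)
  rw [M.conj_of_mem H x hx, LinearMap.comp_id] at h
  rw [mackeyTerm, LinearMap.comp_assoc, LinearMap.comp_assoc, ← M.res_trans, h]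

theorem ind_comp_mackeyTerm {K L H : Subgroup G} (hK : K ≤ H) (hL : L ≤ H) {x : G} (hx : x ∈ H) :
    M.ind hK ∘ₗ M.mackeyTerm K L x = M.ind (inf_le_left.trans hL) ∘ₗ
      M.res (inf_le_left : L ⊓ MulAut.conj x⁻¹ • K ≤ L) := by
  have h := M.ind_conj x (inf_le_left.trans hL) (inf_le_left.trans hK) (conj_inf_eq x K L)
    (conj_smul_self_of_mem hx)
  rw [M.conj_of_mem H x hx, LinearMap.id_comp] at h
  rw [mackeyTerm, ← LinearMap.comp_assoc, ← LinearMap.comp_assoc, ← M.ind_trans, h]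

theorem ind_comp_res_of_eq {K H : Subgroup G} (h : K ≤ H) (e : K = H) :
    M.ind h ∘ₗ M.res h = LinearMap.id := by
  subst e
  rw [M.ind_refl, M.res_refl, LinearMap.comp_id]

variable [Finite G]

/-- The factor |J| in Gluck's formula cancels the |J| in the Mackey weight. What remains for fixed h
depends on J only through L ∩ hJh⁻¹, so the Möbius sum over J is zero. -/
theorem res_comp_topProj {L H : Subgroup G} (hL : L < H) : M.res hL.le ∘ₗ M.topProj H = 0 := by
  have key (J : Subgroup H) : M.res hL.le ∘ₗ ((Nat.card J : ℚ) • M.indRes H J) =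
      (Nat.card L : ℚ)⁻¹ • ∑ h : H,
        M.span H L ((L.subgroupOf H ⊓ MulAut.conj h • J).map H.subtype) := by
    rw [LinearMap.comp_smul, indRes, ← LinearMap.comp_assoc,
      M.res_comp_ind hL.le (Subgroup.map_subtype_le J), linearMap_sum_comp, Finset.smul_sum,
      Finset.smul_sum]
    refine Finset.sum_congr rfl fun h _ => ?_
    rw [LinearMap.smul_comp, M.mackeyTerm_comp_res hL.le (Subgroup.map_subtype_le J) h.2,
      map_subtype_subgroupOf_inf hL.le, M.span_of_le (inf_le_left.trans hL.le) inf_le_left,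
      smul_smul, smul_smul, card_map_subtype]
    congr 1
    have := natCard_ne_zero (G := J)
    have := natCard_ne_zero (G := L)
    field_simp
  rw [topProj_eq_sum, LinearMap.comp_smul, linearMap_comp_sum]
  simp_rw [LinearMap.comp_smul (M.res hL.le) (mobiusWeight H _), key,
    smul_comm (mobiusWeight H _) (Nat.card L : ℚ)⁻¹, Finset.smul_sum]
  rw [Finset.sum_comm]
  simp_rw [← Finset.smul_sum]
  rw [Finset.sum_eq_zero, smul_zero, smul_zero]
  intro h _
  exact sum_mobiusWeight_smul_inf (MulAut.conj h) (subgroupOf_ne_top hL)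
    (fun Q => M.span H L (Q.map H.subtype))

/-- Dual to `res_comp_topProj`: the conjugation is now absorbed on the left, so the intersections
that occur are L ∩ h⁻¹Jh. -/
theorem topProj_comp_ind {L H : Subgroup G} (hL : L < H) : M.topProj H ∘ₗ M.ind hL.le = 0 := by
  have key (J : Subgroup H) : ((Nat.card J : ℚ) • M.indRes H J) ∘ₗ M.ind hL.le =
      (Nat.card L : ℚ)⁻¹ • ∑ h : H,
        M.span L H ((L.subgroupOf H ⊓ MulAut.conj h⁻¹ • J).map H.subtype) := by
    rw [LinearMap.smul_comp, indRes, LinearMap.comp_assoc,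
      M.res_comp_ind (Subgroup.map_subtype_le J) hL.le, linearMap_comp_sum, Finset.smul_sum,
      Finset.smul_sum]
    refine Finset.sum_congr rfl fun h _ => ?_
    rw [LinearMap.comp_smul, M.ind_comp_mackeyTerm (Subgroup.map_subtype_le J) hL.le h.2,
      map_subtype_subgroupOf_inf hL.le, Subgroup.coe_inv,
      M.span_of_le inf_le_left (inf_le_left.trans hL.le),
      smul_smul, smul_smul, card_map_subtype, ← conj_inf_eq, card_smul_aut]
    congr 1
    have := natCard_ne_zero (G := J)
    have := natCard_ne_zero (G := L)
    field_simp
  rw [topProj_eq_sum, LinearMap.smul_comp, linearMap_sum_comp]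
  simp_rw [LinearMap.smul_comp (mobiusWeight H _), key,
    smul_comm (mobiusWeight H _) (Nat.card L : ℚ)⁻¹, Finset.smul_sum]
  rw [Finset.sum_comm]
  simp_rw [← Finset.smul_sum]
  rw [Finset.sum_eq_zero, smul_zero, smul_zero]
  intro h _
  exact sum_mobiusWeight_smul_inf (MulAut.conj h⁻¹) (subgroupOf_ne_top hL)
    (fun Q => M.span L H (Q.map H.subtype))

/-- The term J = H of Gluck's formula has coefficient μ(H, H)|H|/|H| = 1. -/
theorem exists_topProj_eq_add (H : Subgroup G) : ∃ c : Subgroup H → ℚ,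
    M.topProj H = LinearMap.id + ∑ J ∈ Finset.univ.erase ⊤, c J • M.indRes H J := by
  refine ⟨fun J => (Nat.card H : ℚ)⁻¹ * (mobiusWeight H J * Nat.card J), ?_⟩
  have h : M.indRes H ⊤ = LinearMap.id := M.ind_comp_res_of_eq _ (map_subtype_top H)
  rw [topProj_eq_sum, ← Finset.add_sum_erase _ _ (Finset.mem_univ ⊤), h, mobiusWeight_top, one_smul,
    Subgroup.card_top, smul_add, inv_smul_smul₀ natCard_ne_zero, Finset.smul_sum]
  simp_rw [smul_smul]

theorem topProj_apply_of_res_eq_zero {H : Subgroup G} {m : M.obj H}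
    (hm : ∀ (K : Subgroup G) (hK : K < H), M.res hK.le m = 0) : M.topProj H m = m := by
  obtain ⟨c, hc⟩ := M.exists_topProj_eq_add H
  rw [hc, LinearMap.add_apply, LinearMap.sum_apply, Finset.sum_eq_zero, LinearMap.id_apply,
    add_zero]
  intro J hJ
  rw [LinearMap.smul_apply, indRes, LinearMap.comp_apply,
    hm _ (map_subtype_lt (Finset.ne_of_mem_erase hJ)), map_zero, smul_zero]

theorem comp_topProj_of_comp_ind_eq_zero {V : Type*} [AddCommGroup V] [Module ℚ V] {H : Subgroup G}
    (f : M.obj H →ₗ[ℚ] V)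
    (hf : ∀ (K : Subgroup G) (hK : K < H), f ∘ₗ M.ind hK.le = 0) : f ∘ₗ M.topProj H = f := by
  obtain ⟨c, hc⟩ := M.exists_topProj_eq_add H
  rw [hc, LinearMap.comp_add, linearMap_comp_sum, Finset.sum_eq_zero, LinearMap.comp_id, add_zero]
  intro J hJ
  rw [LinearMap.comp_smul, indRes, ← LinearMap.comp_assoc,
    hf _ (map_subtype_lt (Finset.ne_of_mem_erase hJ)), LinearMap.zero_comp, smul_zero]

theorem topProj_idem (H : Subgroup G) : M.topProj H ∘ₗ M.topProj H = M.topProj H :=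
  LinearMap.ext fun m => M.topProj_apply_of_res_eq_zero fun _ hK =>
    LinearMap.congr_fun (M.res_comp_topProj hK) m

/-- The operators `e_K^K R_K^H`, for `K ≤ H`, are jointly injective. -/
theorem eq_zero_of_topProj_res_eq_zero {H : Subgroup G} {m : M.obj H}
    (hm : ∀ (K : Subgroup G) (hK : K ≤ H), M.topProj K (M.res hK m) = 0) : m = 0 := by
  induction H using (wellFounded_lt (α := Subgroup G)).induction with | _ H ih
  -- By induction all proper restrictions of m vanish, so `e_H` fixes m; the hypothesis at K = H
  -- says that `e_H` kills it.
  have h1 : M.topProj H m = m := M.topProj_apply_of_res_eq_zero fun K hK =>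
    ih K hK fun L hL => by
      rw [← LinearMap.comp_apply (M.res hL), ← M.res_trans]
      exact hm L (hL.trans hK.le)
  have h2 := hm H le_rfl
  rwa [M.res_refl, LinearMap.id_apply, h1] at h2

/-- Both sides equal `e_{H'} C_g e_H`: the map `e_{H'} C_g` kills proper inductions, and the image
of `C_g e_H` has zero proper restrictions. This avoids comparing the idempotents of two different
groups. -/
theorem conj_comp_topProj (g : G) {H H' : Subgroup G} (e : MulAut.conj g • H = H') :
    M.conj g e ∘ₗ M.topProj H = M.topProj H' ∘ₗ M.conj g e := by
  have h1 : (M.topProj H' ∘ₗ M.conj g e) ∘ₗ M.topProj H = M.topProj H' ∘ₗ M.conj g e := by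
    refine M.comp_topProj_of_comp_ind_eq_zero _ fun K hK => ?_
    rw [LinearMap.comp_assoc, ← M.ind_conj g hK.le (conj_smul_lt e hK).le rfl e,
      ← LinearMap.comp_assoc,
      M.topProj_comp_ind (conj_smul_lt e hK), LinearMap.zero_comp]
  rw [← h1]
  refine LinearMap.ext fun m => (M.topProj_apply_of_res_eq_zero fun K hK => ?_).symm
  have h2 := M.res_conj g (conj_smul_lt (conj_smul_inv_eq e) hK).le hK.le
    (by rw [map_inv, smul_inv_smul]) e
  rw [← LinearMap.comp_apply, ← LinearMap.comp_assoc, h2, LinearMap.comp_assoc,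
    M.res_comp_topProj (conj_smul_lt (conj_smul_inv_eq e) hK), LinearMap.comp_zero,
    LinearMap.zero_apply]

end MackeyFunctor

/-! ### Extending maps from the top parts -/

theorem conj_inv_smul_le {G : Type u} [Group G] {h : G} {P L : Subgroup G}
    (hP : P ≤ MulAut.conj h • L) : MulAut.conj h⁻¹ • P ≤ L := by
  rwa [map_inv, ← Subgroup.subset_pointwise_smul_iff]

theorem conj_smul_inv_smul {G : Type u} [Group G] (h : G) (P : Subgroup G) :
    MulAut.conj h • MulAut.conj h⁻¹ • P = P := by
  rw [map_inv, smul_inv_smul]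

namespace MackeyFunctor

variable {G : Type u} [Group G]

section

variable (M : MackeyFunctor.{u, v} G)

theorem ind_conj_res_of_eq {P L A B B' : Subgroup G} {x : G} (hA : A ≤ P) (hB : B ≤ L)
    (hB' : B' ≤ L) (e : MulAut.conj x • B = A) (e' : MulAut.conj x • B' = P) (eA : A = P) :
    M.ind hA ∘ₗ M.conj x e ∘ₗ M.res hB = M.conj x e' ∘ₗ M.res hB' := by
  subst eA
  obtain rfl : B = B' := MulAction.injective (MulAut.conj x) (e.trans e'.symm)
  rw [M.ind_refl, LinearMap.id_comp]

variable [Finite G]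

/-- The Mackey terms with P ∩ hLh⁻¹ ≠ P are induced from a proper subgroup and die under θ. In the
others the weight is |P|/(|P||L|) = 1/|L|. -/
theorem comp_res_comp_ind {V : Type*} [AddCommGroup V] [Module ℚ V] {P L H : Subgroup G}
    (hP : P ≤ H) (hL : L ≤ H) (θ : M.obj P →ₗ[ℚ] V)
    (hθ : ∀ (K : Subgroup G) (hK : K < P), θ ∘ₗ M.ind hK.le = 0) :
    θ ∘ₗ M.res hP ∘ₗ M.ind hL = ∑ h : H, if hh : P ≤ MulAut.conj (h : G) • L then
      (Nat.card L : ℚ)⁻¹ • θ ∘ₗ M.conj h (conj_smul_inv_smul (h : G) P) ∘ₗ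
        M.res (conj_inv_smul_le hh) else 0 := by
  rw [M.res_comp_ind hP hL, linearMap_comp_sum]
  refine Finset.sum_congr rfl fun h _ => ?_
  rw [LinearMap.comp_smul]
  split_ifs with hh
  · rw [mackeyTerm, M.ind_conj_res_of_eq _ _ (conj_inv_smul_le hh) _
      (conj_smul_inv_smul (h : G) P) (inf_eq_left.2 hh), inf_eq_left.2 hh]
    congr 1
    have := natCard_ne_zero (G := P)
    field_simp
  · rw [mackeyTerm, ← LinearMap.comp_assoc, hθ _ (inf_lt_left.2 hh), LinearMap.zero_comp, smul_zero]

theorem linearMap_ext_topProj_res {V : Type*} [AddCommGroup V] [Module ℚ V] {H : Subgroup G}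
    {a b : V →ₗ[ℚ] M.obj H}
    (h : ∀ (K : Subgroup G) (hK : K ≤ H),
      (M.topProj K ∘ₗ M.res hK) ∘ₗ a = (M.topProj K ∘ₗ M.res hK) ∘ₗ b) : a = b := by
  refine LinearMap.ext fun m => sub_eq_zero.1 (M.eq_zero_of_topProj_res_eq_zero fun K hK => ?_)
  rw [map_sub, map_sub, sub_eq_zero]
  exact LinearMap.congr_fun (h K hK) m

end

variable [Finite G]

/-- A family of linear maps `e_H^H M(G/H) → e_H^H N(G/H)` that commutes with the conjugation maps;
each of them is given as a map on `M(G/H)` that is zero on the complement. -/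
structure TopHom (M N : MackeyFunctor.{u, v} G) where
  app : ∀ H : Subgroup G, M.obj H →ₗ[ℚ] N.obj H
  app_conj : ∀ (g : G) {H H' : Subgroup G} (e : MulAut.conj g • H = H'),
    app H' ∘ₗ M.conj g e = N.conj g e ∘ₗ app H
  topProj_comp : ∀ H : Subgroup G, N.topProj H ∘ₗ app H = app H
  comp_topProj : ∀ H : Subgroup G, app H ∘ₗ M.topProj H = app H

namespace TopHom

variable {M N : MackeyFunctor.{u, v} G} (f : TopHom M N)

theorem app_comp_ind {K H : Subgroup G} (hK : K < H) : f.app H ∘ₗ M.ind hK.le = 0 := by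
  rw [← f.comp_topProj, LinearMap.comp_assoc, M.topProj_comp_ind hK, LinearMap.comp_zero]

theorem res_comp_app {K H : Subgroup G} (hK : K < H) : N.res hK.le ∘ₗ f.app H = 0 := by
  rw [← f.topProj_comp, ← LinearMap.comp_assoc, N.res_comp_topProj hK, LinearMap.zero_comp]

/-- The map `M(G/H) → N(G/H)` with components `f` on the top parts. -/
def extend (H : Subgroup G) : M.obj H →ₗ[ℚ] N.obj H :=
  ∑ K : Subgroup G, if hK : K ≤ H then
    ((Nat.card K : ℚ) / Nat.card H) • N.ind hK ∘ₗ f.app K ∘ₗ M.res hK else 0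

theorem topProj_res_ind_app_res {K L H : Subgroup G} (hK : K ≤ H) (hL : L ≤ H) :
    (N.topProj L ∘ₗ N.res hL ∘ₗ N.ind hK) ∘ₗ f.app K ∘ₗ M.res hK = ∑ h : H,
      if MulAut.conj (h : G)⁻¹ • L = K then (Nat.card K : ℚ)⁻¹ • f.app L ∘ₗ M.res hL else 0 := by
  rw [N.comp_res_comp_ind hL hK _ fun _ h => N.topProj_comp_ind h, linearMap_sum_comp]
  refine Finset.sum_congr rfl fun h _ => ?_
  split_ifs with h1 h2 h2
  · subst h2
    rw [N.res_refl, LinearMap.comp_id, LinearMap.smul_comp, LinearMap.comp_assoc]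
    congr 1
    -- For h ∈ H the map C_h is trivial on M(G/H), so C_h R_K = R_L.
    have h3 := M.res_conj h hK hL (conj_smul_inv_smul (h : G) L) (conj_smul_self_of_mem h.2)
    rw [M.conj_of_mem H h h.2, LinearMap.comp_id] at h3
    rw [← LinearMap.comp_assoc (M.res hK), ← f.app_conj, LinearMap.comp_assoc, ← h3,
      ← LinearMap.comp_assoc, f.topProj_comp]
  · have h3 := lt_of_le_of_ne (conj_inv_smul_le h1) h2
    rw [LinearMap.smul_comp, LinearMap.comp_assoc, LinearMap.comp_assoc,
      ← LinearMap.comp_assoc (M.res hK), f.res_comp_app h3, LinearMap.zero_comp,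
      LinearMap.comp_zero, LinearMap.comp_zero, smul_zero]
  · exact absurd (by rw [← h2, conj_smul_inv_smul]) h1
  · rw [LinearMap.zero_comp]

/-- Each h ∈ H contributes for exactly one K, namely K = h⁻¹Lh, and there the weight |K|/|H| times
1/|K| is 1/|H|. The |H| equal contributions add up to `f_L R_L`. -/
theorem topProj_res_extend {L H : Subgroup G} (hL : L ≤ H) :
    (N.topProj L ∘ₗ N.res hL) ∘ₗ f.extend H = f.app L ∘ₗ M.res hL := by
  have h1 (K : Subgroup G) : (N.topProj L ∘ₗ N.res hL) ∘ₗ (if hK : K ≤ H then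
      ((Nat.card K : ℚ) / Nat.card H) • N.ind hK ∘ₗ f.app K ∘ₗ M.res hK else 0) =
      ∑ h : H, if MulAut.conj (h : G)⁻¹ • L = K then
        (Nat.card H : ℚ)⁻¹ • f.app L ∘ₗ M.res hL else 0 := by
    split_ifs with hK
    · have h2 : (N.topProj L ∘ₗ N.res hL) ∘ₗ N.ind hK ∘ₗ f.app K ∘ₗ M.res hK = _ :=
        f.topProj_res_ind_app_res hK hL
      rw [LinearMap.comp_smul, h2, Finset.smul_sum]
      refine Finset.sum_congr rfl fun h _ => ?_
      rw [smul_ite, smul_zero, smul_smul]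
      have := natCard_ne_zero (G := K)
      congr 2
      field_simp
    · rw [LinearMap.comp_zero, Finset.sum_eq_zero]
      intro h _
      refine if_neg fun h2 => hK ?_
      rw [← h2]
      exact (Subgroup.pointwise_smul_le_pointwise_smul_iff.2 hL).trans_eq
        (conj_smul_self_of_mem (H.inv_mem h.2))
  rw [extend, linearMap_comp_sum, Finset.sum_congr rfl fun K _ => h1 K, Finset.sum_comm]
  simp_rw [Finset.sum_ite_eq, Finset.mem_univ, if_true]
  rw [Finset.sum_const, Finset.card_univ, ← Nat.card_eq_fintype_card,
    ← Nat.cast_smul_eq_nsmul ℚ, smul_inv_smul₀ natCard_ne_zero]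

theorem res_comp_extend {K H : Subgroup G} (hK : K ≤ H) :
    f.extend K ∘ₗ M.res hK = N.res hK ∘ₗ f.extend H := by
  refine N.linearMap_ext_topProj_res fun L hL => ?_
  rw [← LinearMap.comp_assoc, f.topProj_res_extend, LinearMap.comp_assoc, ← M.res_trans,
    ← LinearMap.comp_assoc, LinearMap.comp_assoc _ _ (N.topProj L), ← N.res_trans,
    f.topProj_res_extend]

theorem conj_comp_extend (g : G) {H H' : Subgroup G} (e : MulAut.conj g • H = H') :
    f.extend H' ∘ₗ M.conj g e = N.conj g e ∘ₗ f.extend H := by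
  refine N.linearMap_ext_topProj_res fun L hL => ?_
  have hL' : MulAut.conj g⁻¹ • L ≤ H := by
    rw [← conj_smul_inv_eq e]
    exact Subgroup.pointwise_smul_le_pointwise_smul_iff.2 hL
  rw [← LinearMap.comp_assoc, f.topProj_res_extend, LinearMap.comp_assoc,
    M.res_conj g hL' hL (conj_smul_inv_smul g L) e, ← LinearMap.comp_assoc (f.extend H),
    LinearMap.comp_assoc (N.conj g e), N.res_conj g hL' hL (conj_smul_inv_smul g L) e,
    ← LinearMap.comp_assoc _ _ (N.topProj L), ← N.conj_comp_topProj, ← LinearMap.comp_assoc,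
    f.app_conj, LinearMap.comp_assoc, LinearMap.comp_assoc, LinearMap.comp_assoc,
    ← LinearMap.comp_assoc (f.extend H), f.topProj_res_extend]

/-- In the L-th coordinate both sides expand by `comp_res_comp_ind`, once with θ = `f_L` and once
with θ = `e_L`. The terms for each h agree by equivariance and `topProj_res_extend`. -/
theorem ind_comp_extend {K H : Subgroup G} (hK : K ≤ H) :
    f.extend H ∘ₗ M.ind hK = N.ind hK ∘ₗ f.extend K := by
  refine N.linearMap_ext_topProj_res fun L hL => ?_
  rw [← LinearMap.comp_assoc, f.topProj_res_extend, LinearMap.comp_assoc,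
    M.comp_res_comp_ind hL hK _ fun _ h => f.app_comp_ind h, ← LinearMap.comp_assoc,
    LinearMap.comp_assoc (N.ind hK), N.comp_res_comp_ind hL hK _ fun _ h => N.topProj_comp_ind h,
    linearMap_sum_comp]
  refine Finset.sum_congr rfl fun h _ => ?_
  split_ifs with hh
  · rw [LinearMap.smul_comp]
    congr 1
    rw [← LinearMap.comp_assoc, f.app_conj, LinearMap.comp_assoc, ← f.topProj_res_extend,
      ← LinearMap.comp_assoc _ (N.conj _ _) (N.topProj L), ← N.conj_comp_topProj]
    rfl
  · rw [LinearMap.zero_comp]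

/-- The morphism of Mackey functors with components `f` on the top parts. -/
def hom : M ⟶ N where
  app := f.extend
  app_res := f.res_comp_extend
  app_ind := f.ind_comp_extend
  app_conj := f.conj_comp_extend

theorem extend_comp_extend (g : TopHom N M) (h : ∀ H, g.app H ∘ₗ f.app H = M.topProj H)
    (H : Subgroup G) : g.extend H ∘ₗ f.extend H = LinearMap.id := by
  refine M.linearMap_ext_topProj_res fun L hL => ?_
  rw [← LinearMap.comp_assoc, g.topProj_res_extend, ← g.comp_topProj, LinearMap.comp_assoc,
    LinearMap.comp_assoc, ← LinearMap.comp_assoc (f.extend H), f.topProj_res_extend,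
    ← LinearMap.comp_assoc, h, LinearMap.comp_id]

/-- Mutually inverse maps on the top parts give an isomorphism of Mackey functors. -/
def iso (g : TopHom N M) (hfg : ∀ H, g.app H ∘ₗ f.app H = M.topProj H)
    (hgf : ∀ H, f.app H ∘ₗ g.app H = N.topProj H) : M ≅ N where
  hom := f.hom
  inv := g.hom
  hom_inv_id := Hom.ext (funext (f.extend_comp_extend g hfg))
  inv_hom_id := Hom.ext (funext (g.extend_comp_extend f hgf))

end TopHom

end MackeyFunctor

/-! ### The modules `e_H^H M(G/H)` determine the Mackey functor -/

namespace MackeyFunctor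

variable {G : Type u} [Group G]

theorem conj_comp_conj_inv {H K : Subgroup G} (M : MackeyFunctor.{u, v} G) {g : G}
    (e : MulAut.conj g • H = K) :
    M.conj g e ∘ₗ M.conj g⁻¹ (conj_smul_inv_eq e) = LinearMap.id := by
  rw [← M.conj_mul g g⁻¹ _ e (by simp)]
  exact M.conj_of_mem K _ (by simp) _

theorem conj_inv_comp_conj {H K : Subgroup G} (M : MackeyFunctor.{u, v} G) {g : G}
    (e : MulAut.conj g • H = K) :
    M.conj g⁻¹ (conj_smul_inv_eq e) ∘ₗ M.conj g e = LinearMap.id := by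
  rw [← M.conj_mul g⁻¹ g e _ (by simp)]
  exact M.conj_of_mem H _ (by simp) _

theorem exists_conj_rep {rep : SubgroupConjClass G → Subgroup G}
    (hrep : ∀ c : SubgroupConjClass G, SubgroupConjClass.mk (rep c) = c)
    (K : Subgroup G) : ∃ g : G, MulAut.conj g • rep (SubgroupConjClass.mk K) = K :=
  Quotient.exact (hrep (SubgroupConjClass.mk K))

/-- The map `M(G/K) → N(G/K)` that corresponds to `f : M(G/H) → N(G/H)`, where `g H g⁻¹ = K`. -/
def transport {M N : MackeyFunctor.{u, v} G} {H K : Subgroup G} (f : M.obj H →ₗ[ℚ] N.obj H) (g : G)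
    (e : MulAut.conj g • H = K) : M.obj K →ₗ[ℚ] N.obj K :=
  N.conj g e ∘ₗ f ∘ₗ M.conj g⁻¹ (conj_smul_inv_eq e)

/-- The element g'⁻¹xg normalizes H, so f commutes with its conjugation map. With x = 1 this shows
that transport does not depend on the conjugating element, so arbitrary choices do no harm. -/
theorem transport_comp_conj {M N : MackeyFunctor.{u, v} G} {H K : Subgroup G}
    (f : M.obj H →ₗ[ℚ] N.obj H)
    (hf : ∀ (n : G) (e : MulAut.conj n • H = H), f ∘ₗ M.conj n e = N.conj n e ∘ₗ f) {g g' x : G}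
    {K' : Subgroup G} (e : MulAut.conj g • H = K) (e' : MulAut.conj g' • H = K')
    (ex : MulAut.conj x • K = K') :
    transport f g' e' ∘ₗ M.conj x ex = N.conj x ex ∘ₗ transport f g e := by
  have en : MulAut.conj (g'⁻¹ * x * g) • H = H := by
    rw [map_mul, map_mul, mul_smul, mul_smul, e, ex, conj_smul_inv_eq e']
  have e1 : MulAut.conj (g'⁻¹ * x) • K = H := by
    rw [map_mul, mul_smul, ex, conj_smul_inv_eq e']
  have h (P : MackeyFunctor.{u, v} G) : P.conj (g'⁻¹ * x * g) en =
      P.conj g'⁻¹ (conj_smul_inv_eq e') ∘ₗ P.conj x ex ∘ₗ P.conj g e := by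
    rw [P.conj_mul (g'⁻¹ * x) g e e1, P.conj_mul g'⁻¹ x ex _ e1, LinearMap.comp_assoc]
  have h1 := congrArg (fun θ => N.conj g' e' ∘ₗ θ ∘ₗ M.conj g⁻¹ (conj_smul_inv_eq e)) (hf _ en)
  rw [h, h] at h1
  simp only [LinearMap.comp_assoc, conj_comp_conj_inv, LinearMap.comp_id] at h1
  rw [← LinearMap.comp_assoc _ (N.conj g'⁻¹ _), conj_comp_conj_inv, LinearMap.id_comp] at h1
  exact h1

variable [Finite G]

/-- The representation of `W_G H` on `e_H^H M(G/H)`. -/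
abbrev topRep (M : MackeyFunctor.{u, v} G) (H : Subgroup G) :
    Representation ℚ (WeylGroup H) (M.topPart H) :=
  (M.weylRep H).subrepresentation (M.topPart H) (M.topPart_le_comap H)

/-- By Gluck's formula the projection is a combination of operators I_J R_J with coefficients that
do not depend on the functor. -/
theorem Hom.topProj_comp_app {M N : MackeyFunctor.{u, v} G} (f : Hom M N) (H : Subgroup G) :
    N.topProj H ∘ₗ f.app H = f.app H ∘ₗ M.topProj H := by
  simp_rw [topProj_eq_sum, LinearMap.smul_comp, LinearMap.comp_smul, linearMap_sum_comp,
    linearMap_comp_sum, LinearMap.smul_comp, LinearMap.comp_smul, indRes, LinearMap.comp_assoc,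
    ← f.app_res, ← LinearMap.comp_assoc, ← f.app_ind]

/-- The map induced on `e_H^H M(G/H)` by a morphism of Mackey functors. -/
def Hom.topMap {M N : MackeyFunctor.{u, v} G} (f : Hom M N) (H : Subgroup G) :
    M.topModule H →ₗ[MonoidAlgebra ℚ (WeylGroup H)] N.topModule H :=
  Representation.IntertwiningMap.equivLinearMapAsModule (M.topRep H) (N.topRep H)
    { toLinearMap := (f.app H).restrict (p := M.topPart H) (q := N.topPart H) (by
        rintro _ ⟨x, rfl⟩
        exact ⟨f.app H x, LinearMap.congr_fun (f.topProj_comp_app H) x⟩)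
      isIntertwining' := fun w => by
        induction w using QuotientGroup.induction_on with | _ n
        refine LinearMap.ext fun x => Subtype.ext ?_
        exact LinearMap.congr_fun (f.app_conj n (conj_eq_of_mem_normalizer n)) x.1 }

/-- The isomorphism of `ℚ[W_G H]`-modules induced by an isomorphism of Mackey functors. -/
def topEquiv {M N : MackeyFunctor.{u, v} G} (α : M ≅ N) (H : Subgroup G) :
    M.topModule H ≃ₗ[MonoidAlgebra ℚ (WeylGroup H)] N.topModule H :=
  LinearEquiv.ofLinearMap (Hom.topMap α.hom H) (Hom.topMap α.inv H)
    (LinearMap.ext fun x => Subtype.ext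
      (LinearMap.congr_fun (congrFun (congrArg Hom.app α.inv_hom_id) H) x.1))
    (LinearMap.ext fun x => Subtype.ext
      (LinearMap.congr_fun (congrFun (congrArg Hom.app α.hom_inv_id) H) x.1))

/-! ### Module maps on the top parts, extended by zero -/

section TopModule

variable {M N : MackeyFunctor.{u, v} G} {H : Subgroup G}

/-- The extension by zero to `M(G/H)` of a map `e_H^H M(G/H) → e_H^H N(G/H)`. -/
def ofTopModule (φ : M.topModule H →ₗ[MonoidAlgebra ℚ (WeylGroup H)] N.topModule H) :
    M.obj H →ₗ[ℚ] N.obj H :=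
  (N.topPart H).subtype ∘ₗ
    ((Representation.IntertwiningMap.equivLinearMapAsModule
      (M.topRep H) (N.topRep H)).symm φ).toLinearMap ∘ₗ (M.topProj H).rangeRestrict

theorem ofTopModule_apply (φ : M.topModule H →ₗ[MonoidAlgebra ℚ (WeylGroup H)] N.topModule H)
    (m : M.obj H) :
    ofTopModule φ m =
      (N.topPart H).subtype (φ ((M.topProj H).rangeRestrict m : M.topPart H)) :=
  rfl

theorem topProj_apply_of_mem {m : M.obj H} (hm : m ∈ M.topPart H) : M.topProj H m = m := by
  obtain ⟨x, rfl⟩ := hm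
  exact LinearMap.congr_fun (M.topProj_idem H) x

theorem topProj_comp_ofTopModule
    (φ : M.topModule H →ₗ[MonoidAlgebra ℚ (WeylGroup H)] N.topModule H) :
    N.topProj H ∘ₗ ofTopModule φ = ofTopModule φ :=
  LinearMap.ext fun _ => topProj_apply_of_mem (Subtype.prop (p := (· ∈ N.topPart H)) _)

theorem rangeRestrict_topProj (m : M.obj H) :
    (M.topProj H).rangeRestrict (M.topProj H m) = (M.topProj H).rangeRestrict m :=
  Subtype.ext (LinearMap.congr_fun (M.topProj_idem H) m)

theorem ofTopModule_comp_topProj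
    (φ : M.topModule H →ₗ[MonoidAlgebra ℚ (WeylGroup H)] N.topModule H) :
    ofTopModule φ ∘ₗ M.topProj H = ofTopModule φ :=
  LinearMap.ext fun m => by
    rw [LinearMap.comp_apply, ofTopModule_apply, rangeRestrict_topProj, ofTopModule_apply]

/-- Linearity over the group algebra gives equivariance on the top part; it passes to the extension
by zero because C_n commutes with the projection. -/
theorem ofTopModule_comp_conj
    (φ : M.topModule H →ₗ[MonoidAlgebra ℚ (WeylGroup H)] N.topModule H) (n : G)
    (e : MulAut.conj n • H = H) : ofTopModule φ ∘ₗ M.conj n e = N.conj n e ∘ₗ ofTopModule φ := by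
  refine LinearMap.ext fun m => ?_
  let n' : Subgroup.normalizer (H : Set G) := ⟨n, Subgroup.mem_normalizer_iff_map_conj_eq.2 e⟩
  have h1 : (M.topProj H).rangeRestrict (M.conj n e m) =
      M.topRep H (n' : WeylGroup H) ((M.topProj H).rangeRestrict m) :=
    Subtype.ext (LinearMap.congr_fun (M.conj_comp_topProj n e).symm m)
  have h2 := LinearMap.congr_fun (((Representation.IntertwiningMap.equivLinearMapAsModule
    (M.topRep H) (N.topRep H)).symm φ).isIntertwining' (n' : WeylGroup H))
    ((M.topProj H).rangeRestrict m)
  rw [LinearMap.comp_apply, ofTopModule_apply, h1]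
  exact congrArg Subtype.val h2

theorem ofTopModule_comp_ofTopModule
    {φ : M.topModule H →ₗ[MonoidAlgebra ℚ (WeylGroup H)] N.topModule H}
    {ψ : N.topModule H →ₗ[MonoidAlgebra ℚ (WeylGroup H)] M.topModule H}
    (h : ∀ x, ψ (φ x) = x) : ofTopModule ψ ∘ₗ ofTopModule φ = M.topProj H := by
  refine LinearMap.ext fun m => ?_
  have h1 : (N.topProj H).rangeRestrict (ofTopModule φ m) =
      (φ ((M.topProj H).rangeRestrict m : M.topPart H) : N.topPart H) :=
    Subtype.ext (LinearMap.congr_fun (topProj_comp_ofTopModule φ) m)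
  rw [LinearMap.comp_apply, ofTopModule_apply, h1]
  exact congrArg Subtype.val (h _)

end TopModule

/-! ### Transport of such maps to conjugate subgroups -/

section Transport

variable {M N : MackeyFunctor.{u, v} G} {H K : Subgroup G}

theorem topProj_comp_transport {f : M.obj H →ₗ[ℚ] N.obj H} (hf : N.topProj H ∘ₗ f = f) (g : G)
    (e : MulAut.conj g • H = K) : N.topProj K ∘ₗ transport f g e = transport f g e := by
  rw [transport, ← LinearMap.comp_assoc, ← N.conj_comp_topProj, LinearMap.comp_assoc,
    ← LinearMap.comp_assoc _ f, hf]

theorem transport_comp_topProj {f : M.obj H →ₗ[ℚ] N.obj H} (hf : f ∘ₗ M.topProj H = f) (g : G)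
    (e : MulAut.conj g • H = K) : transport f g e ∘ₗ M.topProj K = transport f g e := by
  rw [transport, LinearMap.comp_assoc, LinearMap.comp_assoc, M.conj_comp_topProj,
    ← LinearMap.comp_assoc _ _ f, hf]

theorem transport_comp_transport {f : M.obj H →ₗ[ℚ] N.obj H} {f' : N.obj H →ₗ[ℚ] M.obj H}
    (h : f' ∘ₗ f = M.topProj H) (g : G) (e : MulAut.conj g • H = K) :
    transport f' g e ∘ₗ transport f g e = M.topProj K := by
  rw [transport, transport, LinearMap.comp_assoc, LinearMap.comp_assoc,
    ← LinearMap.comp_assoc _ (N.conj g e), conj_inv_comp_conj, LinearMap.id_comp,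
    ← LinearMap.comp_assoc _ f, h, ← LinearMap.comp_assoc, M.conj_comp_topProj,
    LinearMap.comp_assoc, conj_comp_conj_inv, LinearMap.comp_id]

end Transport

section Representatives

variable {M N : MackeyFunctor.{u, v} G} {rep : SubgroupConjClass G → Subgroup G}

/-- The family of maps on the top parts given by module maps for representatives of the conjugacy
classes of subgroups. -/
def topHomOfRep (hrep : ∀ c : SubgroupConjClass G, SubgroupConjClass.mk (rep c) = c)
    (φ : ∀ c, M.topModule (rep c) →ₗ[MonoidAlgebra ℚ (WeylGroup (rep c))] N.topModule (rep c)) :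
    TopHom M N where
  app K :=
    transport (ofTopModule (φ (SubgroupConjClass.mk K))) _ (exists_conj_rep hrep K).choose_spec
  app_conj x K K' ex := by
    -- The classes of K and K' are equal but not definitionally, so the types of the two chosen maps
    -- differ. With the second class as a variable, the equality can be substituted.
    have h (c : SubgroupConjClass G) (hc : c = SubgroupConjClass.mk K) (g g' : G)
        (e : MulAut.conj g • rep (SubgroupConjClass.mk K) = K) (e' : MulAut.conj g' • rep c = K') :
        transport (ofTopModule (φ c)) g' e' ∘ₗ M.conj x ex =
          N.conj x ex ∘ₗ transport (ofTopModule (φ (SubgroupConjClass.mk K))) g e := by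
      subst hc
      exact transport_comp_conj _ (ofTopModule_comp_conj _) e e' ex
    have hK : SubgroupConjClass.mk K = SubgroupConjClass.mk K' := Quotient.sound ⟨x, ex⟩
    exact h _ hK.symm _ _ _ _
  topProj_comp K := topProj_comp_transport (topProj_comp_ofTopModule _) _ _
  comp_topProj K := transport_comp_topProj (ofTopModule_comp_topProj _) _ _

theorem topHomOfRep_comp (hrep : ∀ c : SubgroupConjClass G, SubgroupConjClass.mk (rep c) = c)
    {φ : ∀ c, M.topModule (rep c) →ₗ[MonoidAlgebra ℚ (WeylGroup (rep c))] N.topModule (rep c)}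
    {ψ : ∀ c, N.topModule (rep c) →ₗ[MonoidAlgebra ℚ (WeylGroup (rep c))] M.topModule (rep c)}
    (h : ∀ c x, ψ c (φ c x) = x) (K : Subgroup G) :
    (topHomOfRep hrep ψ).app K ∘ₗ (topHomOfRep hrep φ).app K = M.topProj K :=
  transport_comp_transport (ofTopModule_comp_ofTopModule (h _)) _ _

end Representatives

end MackeyFunctor

end

theorem mainTheorem8 {G : Type u} [Group G] [Finite G] (M N : MackeyFunctor.{u, v} G)
    (rep : SubgroupConjClass G → Subgroup G)
    (hrep : ∀ c : SubgroupConjClass G, SubgroupConjClass.mk (rep c) = c) :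
    Nonempty (M ≅ N) ↔
      ∀ c : SubgroupConjClass G,
        Nonempty (M.topModule (rep c) ≃ₗ[MonoidAlgebra ℚ (WeylGroup (rep c))]
          N.topModule (rep c)) := by
  constructor
  · rintro ⟨α⟩ c
    exact ⟨MackeyFunctor.topEquiv α (rep c)⟩
  · intro h
    let φ c := (h c).some
    exact ⟨(MackeyFunctor.topHomOfRep hrep fun c => (φ c).toLinearMap).iso
      (MackeyFunctor.topHomOfRep hrep fun c => (φ c).symm.toLinearMap)
      (MackeyFunctor.topHomOfRep_comp hrep fun c x => (φ c).symm_apply_apply x)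
      (MackeyFunctor.topHomOfRep_comp hrep fun c x => (φ c).apply_symm_apply x)⟩
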